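/- **Setting.** The statements and constructions of synthetic differential geometry are interpreted in an arbitrary model. Let $k$ be a commutative ring and let $\mathcal C$ be a cartesian closed category with finite limits. "Elements" and "maps" are read in the internal sense, that is, as generalized elements $X\to E$ at an arbitrary stage $X\in\mathcal C$. Let $\mathbb R$ be a commutative $k$-algebra object of $\mathcal C$ which satisfies the general Kock–Lawvere axiom: for every Weil algebra $W$ over $k$ (an augmented commutative $k$-algebra, free of finite rank as a $k$-module, with nilpotent augmentation ideal), the canonical homomorphism $\mathbb R\otimes W\to\mathbb R^{\operatorname{Spec}_{\mathbb R}W}$ is invertible. Objects of the form $\operatorname{Spec}_{\mathbb R}W$ are called infinitesimal. For $n\ge 0$ put $D_n=\{d\in\mathbb R\mid d^{n+1}=0\}$, and put $D=D_1$ and $D(2)=\{(d,e)\in\mathbb R^2\mid d^2=de=e^2=0\}$. An object $M$ is *microlinear* if for every finite cocone of infinitesimal objects which $\mathbb R^{(-)}$ turns into a limit cone, $M^{(-)}$ also turns it into a limit cone. A *Lie group* is a group object whose underlying object is microlinear. If $G$ is a Lie group and $U$ is any object, then $G^U$, with the pointwise multiplication, is a Lie group. The *Lie algebra* of a Lie group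 $G$ is $\mathfrak g=\mathbf{Lie}(G)=\{t\in G^D\mid t(0)=1\}$. Its operations are the following, for $s,t\in\mathfrak g$ and $r\in\mathbb R$: * $(s+t)(d)=\ell(d,d)$, where $\ell:D(2)\to G$ is the unique map with $\ell(d,0)=s(d)$ and $\ell(0,d)=t(d)$ for all $d\in D$; * $(rt)(d)=t(rd)$; * $[s,t]$ is the unique element of $\mathfrak g$ such that $[s,t](de)=s(d)\,t(e)\,s(-d)\,t(-e)$ for all $d,e\in D$. The exponential law $(G^{D_n})^D=G^{D_n\times D}=(G^D)^{D_n}$ restricts to an identification $\mathbf{Lie}(G^{D_n})=\mathfrak g^{D_n}$, since both sides are $\{f\in G^{D_n\times D}\mid f(d,0)=1\ \text{for all}\ d\in D_n\}$. For $X_0,\dots,X_n\in\mathfrak g$, write $\sum_{i=0}^n X_id^i$ for the element of $\mathfrak g^{D_n}$ given by $d\mapsto\sum_{i=0}^n d^iX_i$, $d\in D_n$. **Statement.** Let $G$ be a Lie group with Lie algebra $\mathfrak g$, let $n\ge 0$, and let $X_0,\dots,X_n,Y_0,\dots,Y_n\in\mathfrak g$. Regard $\sum_{i=0}^nX_id^i$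 and $\sum_{j=0}^nY_jd^j$ as elements of $\mathbf{Lie}(G^{D_n})=\mathfrak g^{D_n}$. Then their bracket in the Lie algebra $\mathbf{Lie}(G^{D_n})$ is $$\Big[\sum_{i=0}^nX_id^i,\ \sum_{j=0}^nY_jd^j\Big]=\sum_{k=0}^n\Big(\sum_{i+j=k}[X_i,Y_j]\Big)d^k ,$$ where the brackets on the right-hand side are those of $\mathfrak g$. -/

import Mathlib

open CategoryTheory MonoidalCategory CartesianMonoidalCategory Limits

set_option linter.unusedSectionVars false

universe w v u

noncomputable section

namespace SDG

open scoped MonObj AddMonObj RingObj CommRingObj TensorProduct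

/-- A commutative `k`-algebra object `R` of a cartesian monoidal category `C`: a commutative ring
object together with a homomorphism from `k` to the ring of its global elements. -/
structure AlgObj (k : Type w) [CommRing k] (C : Type u) [Category.{v} C]
    [CartesianMonoidalCategory C] [BraidedCategory C] where
  /-- the underlying object -/
  R : C
  [ring : CommRingObj R]
  /-- the structure homomorphism -/
  coeff : k →+* (𝟙_ C ⟶ R)

attribute [instance] AlgObj.ring

/-- A Weil algebra over `k`: an augmented commutative `k`-algebra which is free of finite rank as
a `k`-module and whose augmentation ideal is nilpotent. -/
def IsWeilAlgebra (k : Type w) [CommRing k] (W : Type w) [CommRing W] [Algebra k W] : Prop :=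
  Module.Free k W ∧ Module.Finite k W ∧ ∃ ε : W →ₐ[k] k, IsNilpotent (RingHom.ker ε)

/-- The object `M` perceives the cocone `c` as a colimit: `M ^ (-)` turns `c` into a limit cone.
This is spelled out on generalized elements: the elements at stage `X` of `M ^ E` are the
morphisms `E ⊗ X ⟶ M`. -/
def PerceivesAsColimit {C : Type u} [Category.{v} C] [CartesianMonoidalCategory C]
    {J : Type} [SmallCategory J] {F : J ⥤ C} (c : Cocone F) (M : C) : Prop :=
  ∀ (X : C) (f : ∀ j, F.obj j ⊗ X ⟶ M), (∀ {i j : J} (φ : i ⟶ j), F.map φ ▷ X ≫ f j = f i) →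
    ∃! g : c.pt ⊗ X ⟶ M, ∀ j, c.ι.app j ▷ X ≫ g = f j

variable {k : Type w} [CommRing k] {C : Type u} [Category.{v} C]
  [CartesianMonoidalCategory C] [BraidedCategory C]

/-- Restriction of `R`-valued functions along `f`, a ring homomorphism. -/
def restr (R : C) [CommRingObj R] {X Y : C} (f : Y ⟶ X) : (X ⟶ R) →+* (Y ⟶ R) where
  toFun a := f ≫ a
  map_one' := MonObj.comp_one f
  map_mul' a b := MonObj.comp_mul f a b
  map_zero' := AddMonObj.comp_zero f
  map_add' a b := AddMonObj.comp_add f a b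

@[simp] lemma restr_apply (R : C) [CommRingObj R] {X Y : C} (f : Y ⟶ X) (a : X ⟶ R) :
    restr R f a = f ≫ a := rfl

namespace AlgObj

variable (L : AlgObj k C)

/-- The elements of `R` at any stage form a `k`-algebra. -/
instance algebra (X : C) : Algebra k (X ⟶ L.R) :=
  ((restr L.R (toUnit X)).comp L.coeff).toAlgebra

lemma algebraMap_def (X : C) (c : k) : algebraMap k (X ⟶ L.R) c = toUnit X ≫ L.coeff c := rfl

/-- Restriction of `R`-valued functions along `f`, as a homomorphism of `k`-algebras. -/
def restrₐ {X Y : C} (f : Y ⟶ X) : (X ⟶ L.R) →ₐ[k] (Y ⟶ L.R) :=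
  { restr L.R f with
    commutes' := fun c => by
      change f ≫ _ = _
      rw [algebraMap_def, algebraMap_def, ← Category.assoc, comp_toUnit] }

@[simp] lemma restrₐ_apply {X Y : C} (f : Y ⟶ X) (a : X ⟶ L.R) : L.restrₐ f a = f ≫ a := rfl

/-- `E`, with the tautological family `t`, is the spectrum `Spec_R W`, i.e. the object of
`k`-algebra homomorphisms from `W` to `R`. -/
def IsSpec (W : Type w) [CommRing W] [Algebra k W] (E : C) (t : W →ₐ[k] (E ⟶ L.R)) : Prop :=
  ∀ X : C, Function.Bijective fun f : X ⟶ E => (L.restrₐ f).comp t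

/-- The infinitesimal objects: the spectra of Weil algebras. -/
def IsInfinitesimal (E : C) : Prop :=
  ∃ (W : Type w) (_ : CommRing W) (_ : Algebra k W) (t : W →ₐ[k] (E ⟶ L.R)),
    IsWeilAlgebra k W ∧ L.IsSpec W E t

/-- The (general) Kock-Lawvere axiom: for every Weil algebra `W`, the canonical homomorphism
`R ⊗ W → R ^ (Spec_R W)` is invertible (at every stage `X`). -/
class KockLawvere : Prop where
  bijective (W : Type w) [CommRing W] [Algebra k W] (E : C) (t : W →ₐ[k] (E ⟶ L.R)) :
    IsWeilAlgebra k W → L.IsSpec W E t → ∀ X : C, Function.Bijective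
      (Algebra.TensorProduct.productMap (L.restrₐ (snd E X)) ((L.restrₐ (fst E X)).comp t) :
        (X ⟶ L.R) ⊗[k] W →ₐ[k] (E ⊗ X ⟶ L.R))

/-- `M` is microlinear: it perceives as a colimit every finite diagram of infinitesimal objects
(with infinitesimal vertex) which `R` perceives as a colimit. -/
class Microlinear (M : C) : Prop where
  perceives (J : Type) [SmallCategory J] [FinCategory J] (F : J ⥤ C) (c : Cocone F) :
    (∀ j, L.IsInfinitesimal (F.obj j)) → L.IsInfinitesimal c.pt →
      PerceivesAsColimit c L.R → PerceivesAsColimit c M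

/-- Exponentials of microlinear objects are microlinear. -/
instance microlinear_ihom [MonoidalClosed C] (U M : C) [L.Microlinear M] :
    L.Microlinear ((ihom U).obj M) where
  perceives J _ _ F c hF hc hR := by
    intro X f hf
    have key := Microlinear.perceives (L := L) (M := M) J F c hF hc hR
    let sw : ∀ E : C, U ⊗ (E ⊗ X) ⟶ E ⊗ (U ⊗ X) := fun E =>
      lift (snd _ _ ≫ fst _ _) (lift (fst _ _) (snd _ _ ≫ snd _ _))
    let sw' : ∀ E : C, E ⊗ (U ⊗ X) ⟶ U ⊗ (E ⊗ X) := fun E =>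
      lift (snd _ _ ≫ fst _ _) (lift (fst _ _) (snd _ _ ≫ snd _ _))
    have h1 : ∀ E, sw E ≫ sw' E = 𝟙 _ := fun E => by ext <;> simp [sw, sw']
    have h2 : ∀ E, sw' E ≫ sw E = 𝟙 _ := fun E => by ext <;> simp [sw, sw']
    have h3 : ∀ {E E' : C} (p : E ⟶ E'), p ▷ (U ⊗ X) ≫ sw' E' = sw' E ≫ U ◁ (p ▷ X) :=
      fun p => by ext <;> simp [sw']
    have h4 : ∀ {E E' : C} (p : E ⟶ E'), sw E ≫ p ▷ (U ⊗ X) = U ◁ (p ▷ X) ≫ sw E' :=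
      fun p => by ext <;> simp [sw]
    obtain ⟨g, hg, hu⟩ := key (U ⊗ X) (fun j => sw' _ ≫ MonoidalClosed.uncurry (f j)) (by
      intro i j φ
      rw [← Category.assoc, h3, Category.assoc, ← MonoidalClosed.uncurry_natural_left, hf])
    refine ⟨MonoidalClosed.curry (sw _ ≫ g), fun j => ?_, fun g' hg' => ?_⟩
    · rw [← MonoidalClosed.curry_natural_left, MonoidalClosed.curry_eq_iff, ← Category.assoc,
        ← h4 (E' := c.pt) (c.ι.app j),
        Category.assoc, hg, ← Category.assoc, h1, Category.id_comp]
    · rw [MonoidalClosed.eq_curry_iff, ← hu (sw' _ ≫ MonoidalClosed.uncurry g'),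
        ← Category.assoc, h1, Category.id_comp]
      intro j
      rw [← Category.assoc, h3 (E' := c.pt) (c.ι.app j), Category.assoc,
        ← MonoidalClosed.uncurry_natural_left, hg']

variable [HasFiniteLimits C]

/-- The object `D n = {d ∈ R | d ^ (n + 1) = 0}`. -/
def D (n : ℕ) : C := equalizer ((𝟙 L.R) ^ (n + 1)) 0

/-- The inclusion of `D n` in `R`. -/
def incl (n : ℕ) : L.D n ⟶ L.R := equalizer.ι _ _

instance (n : ℕ) : Mono (L.incl n) := inferInstanceAs (Mono (equalizer.ι _ _))

lemma incl_pow (n : ℕ) : L.incl n ^ (n + 1) = 0 := by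
  have h := equalizer.condition ((𝟙 L.R) ^ (n + 1)) (0 : L.R ⟶ L.R)
  rw [MonObj.comp_pow, Category.comp_id, AddMonObj.comp_zero] at h
  exact h

variable {L} in
lemma pt_pow {n : ℕ} {X : C} (e : X ⟶ L.D n) : (e ≫ L.incl n) ^ (n + 1) = 0 := by
  rw [← MonObj.comp_pow, incl_pow, AddMonObj.comp_zero]

variable {L} in
/-- The element of `D n` with underlying element `r` of `R`. -/
def pt {n : ℕ} {X : C} (r : X ⟶ L.R) (h : r ^ (n + 1) = 0) : X ⟶ L.D n :=
  equalizer.lift r (by rw [MonObj.comp_pow, Category.comp_id, AddMonObj.comp_zero, h])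

@[simp] lemma pt_incl {n : ℕ} {X : C} (r : X ⟶ L.R) (h : r ^ (n + 1) = 0) :
    pt r h ≫ L.incl n = r := equalizer.lift_ι _ _

/-- The element `0` of `D n`. -/
def zero (n : ℕ) (X : C) : X ⟶ L.D n := pt 0 (by simp)

@[simp] lemma zero_incl (n : ℕ) (X : C) : L.zero n X ≫ L.incl n = 0 := pt_incl _ _ _

variable {L} in
lemma D_ext {n : ℕ} {X : C} {a b : X ⟶ L.D n} (h : a ≫ L.incl n = b ≫ L.incl n) :
    a = b := by
  rwa [cancel_mono] at h

@[simp] lemma comp_zeroD {n : ℕ} {X Y : C} (f : Y ⟶ X) : f ≫ L.zero n X = L.zero n Y := by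
  apply D_ext
  simp [AddMonObj.comp_zero]

variable {L} in
/-- The product `r • e` of an element `r` of `R` and an element `e` of `D = D 1`. -/
def scale {X : C} (r : X ⟶ L.R) (e : X ⟶ L.D 1) : X ⟶ L.D 1 :=
  pt (r * (e ≫ L.incl 1)) (by rw [mul_pow, pt_pow, mul_zero])

@[simp] lemma scale_incl {X : C} (r : X ⟶ L.R) (e : X ⟶ L.D 1) :
    scale r e ≫ L.incl 1 = r * (e ≫ L.incl 1) := pt_incl _ _ _

lemma comp_scale {X Y : C} (f : Y ⟶ X) (r : X ⟶ L.R) (e : X ⟶ L.D 1) :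
    f ≫ scale r e = scale (f ≫ r) (f ≫ e) := by
  apply D_ext
  simp [MonObj.comp_mul]

/-- The object `D(2) = {(d, e) ∈ R × R | d ^ 2 = d * e = e ^ 2 = 0}`. -/
def D₂ : C := equalizer
  (lift (fst L.R L.R ^ 2) (lift (fst L.R L.R * snd L.R L.R) (snd L.R L.R ^ 2)))
  (lift 0 (lift 0 0))

/-- The inclusion of `D(2)` in `R × R`. -/
def incl₂ : L.D₂ ⟶ L.R ⊗ L.R := equalizer.ι _ _

instance : Mono L.incl₂ := inferInstanceAs (Mono (equalizer.ι _ _))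

variable {L} in
/-- The element `(r, s)` of `D(2)`. -/
def pt₂ {X : C} (r s : X ⟶ L.R) (h₁ : r ^ 2 = 0) (h₂ : r * s = 0) (h₃ : s ^ 2 = 0) : X ⟶ L.D₂ :=
  equalizer.lift (lift r s) (by
    simp [comp_lift, MonObj.comp_pow, MonObj.comp_mul, AddMonObj.comp_zero, h₁, h₂, h₃])

@[simp] lemma pt₂_incl₂ {X : C} (r s : X ⟶ L.R) (h₁ h₂ h₃) :
    pt₂ r s h₁ h₂ h₃ ≫ L.incl₂ = lift r s := equalizer.lift_ι _ _

/-- The first coordinate on `D(2)`. -/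
def p₁ : L.D₂ ⟶ L.R := L.incl₂ ≫ fst _ _

/-- The second coordinate on `D(2)`. -/
def p₂ : L.D₂ ⟶ L.R := L.incl₂ ≫ snd _ _

@[simp] lemma pt₂_p₁ {X : C} (r s : X ⟶ L.R) (h₁ h₂ h₃) : pt₂ r s h₁ h₂ h₃ ≫ L.p₁ = r := by
  rw [p₁, ← Category.assoc, pt₂_incl₂, lift_fst]

@[simp] lemma pt₂_p₂ {X : C} (r s : X ⟶ L.R) (h₁ h₂ h₃) : pt₂ r s h₁ h₂ h₃ ≫ L.p₂ = s := by
  rw [p₂, ← Category.assoc, pt₂_incl₂, lift_snd]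

variable {L} in
lemma D₂_ext {X : C} {a b : X ⟶ L.D₂} (h₁ : a ≫ L.p₁ = b ≫ L.p₁) (h₂ : a ≫ L.p₂ = b ≫ L.p₂) :
    a = b := by
  rw [← cancel_mono L.incl₂]
  apply CartesianMonoidalCategory.hom_ext
  · simpa [p₁] using h₁
  · simpa [p₂] using h₂

lemma D₂_rel : L.p₁ ^ 2 = 0 ∧ L.p₁ * L.p₂ = 0 ∧ L.p₂ ^ 2 = 0 := by
  have h : L.incl₂ ≫ _ = L.incl₂ ≫ _ := equalizer.condition
    (lift (fst L.R L.R ^ 2) (lift (fst L.R L.R * snd L.R L.R) (snd L.R L.R ^ 2)))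
    (lift 0 (lift 0 0))
  simp only [comp_lift, MonObj.comp_pow, MonObj.comp_mul, AddMonObj.comp_zero] at h
  refine ⟨?_, ?_, ?_⟩
  · simpa [p₁, p₂] using congr($h ≫ fst _ _)
  · simpa [p₁, p₂] using congr($h ≫ snd _ _ ≫ fst _ _)
  · simpa [p₁, p₂] using congr($h ≫ snd _ _ ≫ snd _ _)

/-- The inclusion `d ↦ (d, 0)` of `D` in `D(2)`. -/
def i₁ : L.D 1 ⟶ L.D₂ := pt₂ (L.incl 1) 0 (L.incl_pow 1) (by simp) (by simp)

/-- The inclusion `d ↦ (0, d)` of `D` in `D(2)`. -/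
def i₂ : L.D 1 ⟶ L.D₂ := pt₂ 0 (L.incl 1) (by simp) (by simp) (L.incl_pow 1)

/-- The diagonal `d ↦ (d, d)` of `D` in `D(2)`. -/
def diag : L.D 1 ⟶ L.D₂ :=
  pt₂ (L.incl 1) (L.incl 1) (L.incl_pow 1) (by rw [← sq]; exact L.incl_pow 1) (L.incl_pow 1)

/-- The multiplication `(d, e) ↦ d * e` from `D × D` to `D`. -/
def mulD : L.D 1 ⊗ L.D 1 ⟶ L.D 1 := scale (fst _ _ ≫ L.incl 1) (snd _ _)

/-- The inclusion of `D(2)` in `D × D`. -/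
def toProd : L.D₂ ⟶ L.D 1 ⊗ L.D 1 := lift (pt L.p₁ L.D₂_rel.1) (pt L.p₂ L.D₂_rel.2.2)

section Weil

lemma isWeilAlgebra_self : IsWeilAlgebra k k :=
  ⟨inferInstance, inferInstance, AlgHom.id k k, 1, by
    rw [pow_one, Ideal.zero_eq_bot]
    exact (RingHom.injective_iff_ker_eq_bot _).1 Function.injective_id⟩

lemma isWeilAlgebra_trivSqZeroExt (M : Type w) [AddCommGroup M] [Module k M] [Module kᵐᵒᵖ M]
    [IsCentralScalar k M] [Module.Free k M] [Module.Finite k M] :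
    IsWeilAlgebra k (TrivSqZeroExt k M) := by
  refine ⟨inferInstanceAs (Module.Free k (k × M)), inferInstanceAs (Module.Finite k (k × M)),
    TrivSqZeroExt.fstHom k k M, 2, ?_⟩
  rw [Ideal.zero_eq_bot, eq_bot_iff, sq, Ideal.mul_le]
  intro r hr s hs
  rw [RingHom.mem_ker] at hr hs
  have hr' : r.fst = 0 := hr
  have hs' : s.fst = 0 := hs
  rw [Ideal.mem_bot]
  ext <;> simp [hr', hs']

lemma isWeilAlgebra_tensor {W W' : Type w} [CommRing W] [Algebra k W] [CommRing W'] [Algebra k W']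
    (h : IsWeilAlgebra k W) (h' : IsWeilAlgebra k W') : IsWeilAlgebra k (W ⊗[k] W') := by
  obtain ⟨hf, hfin, a, m, hm⟩ := h
  obtain ⟨hf', hfin', a', m', hm'⟩ := h'
  refine ⟨inferInstance, inferInstance,
    (Algebra.TensorProduct.lid k k).toAlgHom.comp (Algebra.TensorProduct.map a a'), m + m', ?_⟩
  have ha : Function.Surjective a := fun c => ⟨algebraMap k W c, by simp⟩
  have ha' : Function.Surjective a' := fun c => ⟨algebraMap k W' c, by simp⟩
  have hk : RingHom.ker ((Algebra.TensorProduct.lid k k).toAlgHom.comp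
      (Algebra.TensorProduct.map a a')) = RingHom.ker (Algebra.TensorProduct.map a a') := by
    ext x
    simp [RingHom.mem_ker]
  rw [hk, Algebra.TensorProduct.map_ker _ _ ha ha', Ideal.zero_eq_bot, eq_bot_iff]
  refine Ideal.sup_pow_add_le_pow_sup_pow.trans ?_
  rw [← Ideal.map_pow, ← Ideal.map_pow, hm, hm']
  simp

end Weil

lemma isSpec_unit : L.IsSpec k (𝟙_ C) (Algebra.ofId k _) := by
  intro X
  refine ⟨fun f g _ => toUnit_unique f g, fun f => ⟨toUnit X, ?_⟩⟩
  exact Subsingleton.elim _ _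

variable {L} in
lemma IsSpec.prod {W W' : Type w} [CommRing W] [Algebra k W] [CommRing W'] [Algebra k W']
    {E E' : C} {t : W →ₐ[k] (E ⟶ L.R)} {t' : W' →ₐ[k] (E' ⟶ L.R)}
    (h : L.IsSpec W E t) (h' : L.IsSpec W' E' t') :
    L.IsSpec (W ⊗[k] W') (E ⊗ E') (Algebra.TensorProduct.productMap
      ((L.restrₐ (fst E E')).comp t) ((L.restrₐ (snd E E')).comp t')) := by
  intro X
  constructor
  · intro f g hfg
    apply CartesianMonoidalCategory.hom_ext
    · apply (h X).1
      ext x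
      simpa using congr($hfg (x ⊗ₜ 1))
    · apply (h' X).1
      ext x
      simpa using congr($hfg (1 ⊗ₜ x))
  · intro q
    obtain ⟨f, hf⟩ := (h X).2 (q.comp Algebra.TensorProduct.includeLeft)
    obtain ⟨g, hg⟩ := (h' X).2 (q.comp Algebra.TensorProduct.includeRight)
    refine ⟨lift f g, ?_⟩
    ext x
    · simpa using congr($hf x)
    · simpa using congr($hg x)

/-- The homomorphism from the dual numbers given by an element of square zero. -/
def dualLift {A : Type*} [CommRing A] [Algebra k A] (a : A) (h : a ^ 2 = 0) :
    TrivSqZeroExt k k →ₐ[k] A :=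
  TrivSqZeroExt.lift (Algebra.ofId k _) (LinearMap.toSpanSingleton k _ a)
    (fun x y => by
      simp only [LinearMap.toSpanSingleton_apply, smul_mul_smul_comm]
      rw [← sq, h, smul_zero])
    (fun r x => by simp [Algebra.ofId_apply, Algebra.smul_def, mul_assoc])
    (fun r x => by simp [Algebra.ofId_apply, Algebra.smul_def]; ring)

/-- The homomorphism given by two elements with zero products. -/
def dualLift₂ {A : Type*} [CommRing A] [Algebra k A] (a b : A) (h₁ : a ^ 2 = 0) (h₂ : a * b = 0)
    (h₃ : b ^ 2 = 0) : TrivSqZeroExt k (k × k) →ₐ[k] A :=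
  TrivSqZeroExt.lift (Algebra.ofId k _)
    ((LinearMap.toSpanSingleton k _ a).coprod (LinearMap.toSpanSingleton k _ b))
    (fun x y => by
      have h₄ : b * a = 0 := by rw [mul_comm, h₂]
      simp only [LinearMap.coprod_apply, LinearMap.toSpanSingleton_apply, add_mul, mul_add,
        smul_mul_smul_comm, h₂, h₄, ← sq, h₁, h₃, smul_zero, add_zero])
    (fun r x => by simp [Algebra.ofId_apply, Algebra.smul_def, mul_add, mul_assoc])
    (fun r x => by simp [Algebra.ofId_apply, Algebra.smul_def]; ring)

lemma dualLift_inr {A : Type*} [CommRing A] [Algebra k A] (a : A) (h : a ^ 2 = 0) (c : k) :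
    dualLift a h (TrivSqZeroExt.inr c) = c • a := by
  rw [dualLift, TrivSqZeroExt.lift_apply_inr, LinearMap.toSpanSingleton_apply]

lemma dualLift₂_inr {A : Type*} [CommRing A] [Algebra k A] (a b : A) (h₁ : a ^ 2 = 0)
    (h₂ : a * b = 0) (h₃ : b ^ 2 = 0) (c : k × k) :
    dualLift₂ a b h₁ h₂ h₃ (TrivSqZeroExt.inr c) = c.1 • a + c.2 • b := by
  rw [dualLift₂, TrivSqZeroExt.lift_apply_inr, LinearMap.coprod_apply,
    LinearMap.toSpanSingleton_apply, LinearMap.toSpanSingleton_apply]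

/-- The tautological family over `D`. -/
def tautD : TrivSqZeroExt k k →ₐ[k] (L.D 1 ⟶ L.R) := dualLift (L.incl 1) (L.incl_pow 1)

/-- The tautological family over `D(2)`. -/
def tautD₂ : TrivSqZeroExt k (k × k) →ₐ[k] (L.D₂ ⟶ L.R) :=
  dualLift₂ L.p₁ L.p₂ L.D₂_rel.1 L.D₂_rel.2.1 L.D₂_rel.2.2

lemma tautD_inr (c : k) : L.tautD (TrivSqZeroExt.inr c) = c • L.incl 1 := dualLift_inr _ _ _

lemma tautD₂_inr (c : k × k) :
    L.tautD₂ (TrivSqZeroExt.inr c) = c.1 • L.p₁ + c.2 • L.p₂ := dualLift₂_inr _ _ _ _ _ _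

lemma isSpec_D : L.IsSpec (TrivSqZeroExt k k) (L.D 1) L.tautD := by
  intro X
  constructor
  · intro f g hfg
    apply D_ext
    have h : f ≫ L.tautD (TrivSqZeroExt.inr 1) = g ≫ L.tautD (TrivSqZeroExt.inr 1) :=
      DFunLike.congr_fun hfg _
    rwa [tautD_inr, one_smul] at h
  · intro q
    refine ⟨pt (q (TrivSqZeroExt.inr 1)) (by rw [← map_pow, sq]; simp), ?_⟩
    apply TrivSqZeroExt.algHom_ext
    intro m
    have : (TrivSqZeroExt.inr m : TrivSqZeroExt k k) = m • TrivSqZeroExt.inr 1 := by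
      rw [← TrivSqZeroExt.inr_smul]; simp
    rw [this, map_smul, map_smul]
    rw [AlgHom.comp_apply]
    congr 1
    exact (congrArg _ ((L.tautD_inr 1).trans (one_smul _ _))).trans (pt_incl _ _ _)

lemma isSpec_D₂ : L.IsSpec (TrivSqZeroExt k (k × k)) L.D₂ L.tautD₂ := by
  intro X
  constructor
  · intro f g hfg
    apply D₂_ext
    · have h : f ≫ L.tautD₂ (TrivSqZeroExt.inr (1, 0)) = g ≫ L.tautD₂ (TrivSqZeroExt.inr (1, 0)) :=
        DFunLike.congr_fun hfg _
      simpa [tautD₂_inr] using h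
    · have h : f ≫ L.tautD₂ (TrivSqZeroExt.inr (0, 1)) = g ≫ L.tautD₂ (TrivSqZeroExt.inr (0, 1)) :=
        DFunLike.congr_fun hfg _
      simpa [tautD₂_inr] using h
  · intro q
    refine ⟨pt₂ (q (TrivSqZeroExt.inr (1, 0))) (q (TrivSqZeroExt.inr (0, 1)))
      (by rw [← map_pow, sq]; simp) (by rw [← map_mul]; simp) (by rw [← map_pow, sq]; simp), ?_⟩
    apply TrivSqZeroExt.algHom_ext
    intro m
    have : (TrivSqZeroExt.inr m : TrivSqZeroExt k (k × k)) =
        m.1 • TrivSqZeroExt.inr (1, 0) + m.2 • TrivSqZeroExt.inr (0, 1) := by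
      rw [← TrivSqZeroExt.inr_smul, ← TrivSqZeroExt.inr_smul, ← TrivSqZeroExt.inr_add]; simp
    rw [this, map_add, map_add, map_smul, map_smul, map_smul, map_smul]
    simp [tautD₂_inr]

lemma isInfinitesimal_unit : L.IsInfinitesimal (𝟙_ C) :=
  ⟨k, _, _, _, isWeilAlgebra_self, L.isSpec_unit⟩

lemma isInfinitesimal_D : L.IsInfinitesimal (L.D 1) :=
  ⟨_, _, _, _, isWeilAlgebra_trivSqZeroExt k, L.isSpec_D⟩

lemma isInfinitesimal_D₂ : L.IsInfinitesimal L.D₂ :=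
  ⟨_, _, _, _, isWeilAlgebra_trivSqZeroExt (k × k), L.isSpec_D₂⟩

lemma isInfinitesimal_prod : L.IsInfinitesimal (L.D 1 ⊗ L.D 1) :=
  ⟨_, _, _, _, isWeilAlgebra_tensor (isWeilAlgebra_trivSqZeroExt k)
    (isWeilAlgebra_trivSqZeroExt k), L.isSpec_D.prod L.isSpec_D⟩

variable {L} in
lemma expand [L.KockLawvere] {W : Type w} [CommRing W] [Algebra k W] {E : C}
    {t : W →ₐ[k] (E ⟶ L.R)} (hW : IsWeilAlgebra k W) (h : L.IsSpec W E t) {κ : Type} [Fintype κ]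
    (b : Module.Basis κ k W) (X : C) :
    Function.Bijective (fun c : κ → (X ⟶ L.R) =>
      (∑ i, (snd E X ≫ c i) * (fst E X ≫ t (b i)) : E ⊗ X ⟶ L.R)) := by
  classical
  have h1 := KockLawvere.bijective W E t hW h X
  have h2 := (TensorProduct.equivFinsuppOfBasisRight (M := (X ⟶ L.R)) b).symm.bijective
  have h3 := (Finsupp.linearEquivFunOnFinite k (X ⟶ L.R) κ).symm.bijective
  convert (h1.comp h2).comp h3 using 1
  ext c
  simp [Finsupp.sum_fintype]

lemma bij_D [L.KockLawvere] (X : C) :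
    Function.Bijective (fun c : Unit ⊕ Unit → (X ⟶ L.R) =>
      (snd _ _ ≫ c (.inl ()) + (snd _ _ ≫ c (.inr ())) * (fst _ _ ≫ L.incl 1) :
        L.D 1 ⊗ X ⟶ L.R)) := by
  let b : Module.Basis (Unit ⊕ Unit) k (TrivSqZeroExt k k) :=
    ((Module.Basis.singleton Unit k).prod (Module.Basis.singleton Unit k) :
      Module.Basis (Unit ⊕ Unit) k (k × k))
  have hb₀ : b (.inl ()) = 1 := by
    refine Prod.ext ?_ ?_
    · exact (Module.Basis.prod_apply_inl_fst _ _ _).trans (Module.Basis.singleton_apply _ _ _)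
    · exact Module.Basis.prod_apply_inl_snd _ _ _
  have hb₁ : b (.inr ()) = TrivSqZeroExt.inr 1 := by
    refine Prod.ext ?_ ?_
    · exact Module.Basis.prod_apply_inr_fst _ _ _
    · exact (Module.Basis.prod_apply_inr_snd _ _ _).trans (Module.Basis.singleton_apply _ _ _)
  have h := expand (isWeilAlgebra_trivSqZeroExt k) L.isSpec_D b X
  convert h using 3 with c
  simp only [Fintype.sum_sum_type, Finset.univ_unique, Finset.sum_singleton]
  rw [show (default : Unit) = () from rfl, hb₀, hb₁, map_one, tautD_inr, one_smul,
    MonObj.comp_one, mul_one]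

lemma bij_D₂ [L.KockLawvere] (X : C) :
    Function.Bijective (fun c : Unit ⊕ Fin 2 → (X ⟶ L.R) =>
      (snd _ _ ≫ c (.inl ()) + ((snd _ _ ≫ c (.inr 0)) * (fst _ _ ≫ L.p₁) +
        (snd _ _ ≫ c (.inr 1)) * (fst _ _ ≫ L.p₂)) : L.D₂ ⊗ X ⟶ L.R)) := by
  let b : Module.Basis (Unit ⊕ Fin 2) k (TrivSqZeroExt k (k × k)) :=
    ((Module.Basis.singleton Unit k).prod (Module.Basis.finTwoProd k) :
      Module.Basis (Unit ⊕ Fin 2) k (k × (k × k)))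
  have hb₀ : b (.inl ()) = 1 := by
    refine Prod.ext ?_ ?_
    · exact (Module.Basis.prod_apply_inl_fst _ _ _).trans (Module.Basis.singleton_apply _ _ _)
    · exact Module.Basis.prod_apply_inl_snd _ _ _
  have hb₁ : b (.inr 0) = TrivSqZeroExt.inr (1, 0) := by
    refine Prod.ext ?_ ?_
    · exact Module.Basis.prod_apply_inr_fst _ _ _
    · exact (Module.Basis.prod_apply_inr_snd _ _ _).trans (Module.Basis.finTwoProd_zero _)
  have hb₂ : b (.inr 1) = TrivSqZeroExt.inr (0, 1) := by
    refine Prod.ext ?_ ?_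
    · exact Module.Basis.prod_apply_inr_fst _ _ _
    · exact (Module.Basis.prod_apply_inr_snd _ _ _).trans (Module.Basis.finTwoProd_one _)
  have h := expand (isWeilAlgebra_trivSqZeroExt (k × k)) L.isSpec_D₂ b X
  convert h using 3 with c
  simp only [Fintype.sum_sum_type, Finset.univ_unique, Finset.sum_singleton, Fin.sum_univ_two]
  rw [show (default : Unit) = () from rfl, hb₀, hb₁, hb₂, map_one, tautD₂_inr, tautD₂_inr,
    MonObj.comp_one, mul_one]
  simp

section Perceive

lemma perceives_pushout_iff {A B E : C} {f : A ⟶ B} {g : A ⟶ E} (c : PushoutCocone f g) (M : C) :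
    PerceivesAsColimit c M ↔ ∀ (X : C) (a : B ⊗ X ⟶ M) (b : E ⊗ X ⟶ M),
      f ▷ X ≫ a = g ▷ X ≫ b → ∃! h : c.pt ⊗ X ⟶ M, c.inl ▷ X ≫ h = a ∧ c.inr ▷ X ≫ h = b := by
  constructor
  · intro H X a b hab
    let q : ∀ j : WalkingSpan, (span f g).obj j ⊗ X ⟶ M := fun j =>
      match j with
      | none => f ▷ X ≫ a
      | some .left => a
      | some .right => b
    obtain ⟨h, hh, hu⟩ := H X q (by
      intro i j φ
      change WidePushoutShape.Hom i j at φ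
      cases φ with
      | id => exact (congrArg (· ▷ X ≫ q i) ((span f g).map_id i)).trans (by simp)
      | init j =>
        cases j with
        | left => rfl
        | right => exact hab.symm)
    exact ⟨h, ⟨hh (some .left), hh (some .right)⟩, fun h' hh' => hu h' (by
      intro j
      match j with
      | none =>
        rw [← c.w WalkingSpan.Hom.fst, comp_whiskerRight, Category.assoc]
        exact congrArg (f ▷ X ≫ ·) hh'.1
      | some .left => exact hh'.1
      | some .right => exact hh'.2)⟩
  · intro H X q hq
    obtain ⟨h, hh, hu⟩ := H X (q (some .left)) (q (some .right))
      ((hq WalkingSpan.Hom.fst).trans (hq WalkingSpan.Hom.snd).symm)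
    refine ⟨h, fun j => ?_, fun h' hh' => hu h' ⟨hh' (some .left), hh' (some .right)⟩⟩
    match j with
    | none =>
      rw [← c.w WalkingSpan.Hom.fst, comp_whiskerRight, Category.assoc, ← hq WalkingSpan.Hom.fst]
      exact congrArg (f ▷ X ≫ ·) hh.1
    | some .left => exact hh.1
    | some .right => exact hh.2

lemma perceives_cofork_iff {A B : C} {f g : A ⟶ B} (c : Cofork f g) (M : C) :
    PerceivesAsColimit c M ↔ ∀ (X : C) (a : B ⊗ X ⟶ M),
      f ▷ X ≫ a = g ▷ X ≫ a → ∃! h : c.pt ⊗ X ⟶ M, c.π ▷ X ≫ h = a := by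
  constructor
  · intro H X a ha
    let q : ∀ j : WalkingParallelPair, (parallelPair f g).obj j ⊗ X ⟶ M := fun j =>
      match j with
      | .zero => f ▷ X ≫ a
      | .one => a
    obtain ⟨h, hh, hu⟩ := H X q (by
      intro i j φ
      change WalkingParallelPairHom i j at φ
      cases φ with
      | id => exact (congrArg (· ▷ X ≫ q i) ((parallelPair f g).map_id i)).trans (by simp)
      | left => rfl
      | right => exact ha.symm)
    exact ⟨h, hh .one, fun h' hh' => hu h' (by
      intro j
      match j with
      | .zero =>
        rw [← c.w WalkingParallelPairHom.left, comp_whiskerRight, Category.assoc]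
        exact congrArg (f ▷ X ≫ ·) hh'
      | .one => exact hh')⟩
  · intro H X q hq
    obtain ⟨h, hh, hu⟩ := H X (q .one) ((hq .left).trans (hq .right).symm)
    refine ⟨h, fun j => ?_, fun h' hh' => hu h' (hh' .one)⟩
    match j with
    | .zero =>
      rw [← c.w WalkingParallelPairHom.left, comp_whiskerRight, Category.assoc,
        ← hq WalkingParallelPairHom.left]
      exact congrArg (f ▷ X ≫ ·) hh
    | .one => exact hh

end Perceive

@[simp] lemma i₁_p₁ : L.i₁ ≫ L.p₁ = L.incl 1 := pt₂_p₁ _ _ _ _ _ _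
@[simp] lemma i₁_p₂ : L.i₁ ≫ L.p₂ = 0 := pt₂_p₂ _ _ _ _ _ _
@[simp] lemma i₂_p₁ : L.i₂ ≫ L.p₁ = 0 := pt₂_p₁ _ _ _ _ _ _
@[simp] lemma i₂_p₂ : L.i₂ ≫ L.p₂ = L.incl 1 := pt₂_p₂ _ _ _ _ _ _

lemma zero_i : L.zero 1 (𝟙_ C) ≫ L.i₁ = L.zero 1 (𝟙_ C) ≫ L.i₂ := by
  apply D₂_ext <;> simp [AddMonObj.comp_zero]

lemma const_inj {E X M : C} (z : 𝟙_ C ⟶ E) {a b : X ⟶ M} (h : snd E X ≫ a = snd E X ≫ b) :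
    a = b := by
  have := congr(lift (toUnit X ≫ z) (𝟙 X) ≫ $h)
  simpa using this

lemma ring_D₂ [L.KockLawvere] (X : C) (a b : L.D 1 ⊗ X ⟶ L.R)
    (hab : L.zero 1 (𝟙_ C) ▷ X ≫ a = L.zero 1 (𝟙_ C) ▷ X ≫ b) :
    ∃! f : L.D₂ ⊗ X ⟶ L.R, L.i₁ ▷ X ≫ f = a ∧ L.i₂ ▷ X ≫ f = b := by
  obtain ⟨c, rfl⟩ := (L.bij_D X).2 a
  obtain ⟨c', rfl⟩ := (L.bij_D X).2 b
  simp only [AddMonObj.comp_add, MonObj.comp_mul, whiskerRight_fst_assoc,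
    whiskerRight_snd_assoc, zero_incl, AddMonObj.comp_zero, mul_zero, add_zero] at hab
  have h0 : c (.inl ()) = c' (.inl ()) := const_inj (𝟙 _) hab
  refine ⟨snd _ _ ≫ c (.inl ()) + ((snd _ _ ≫ c (.inr ())) * (fst _ _ ≫ L.p₁) +
    (snd _ _ ≫ c' (.inr ())) * (fst _ _ ≫ L.p₂)), ⟨?_, ?_⟩, ?_⟩
  · simp only [AddMonObj.comp_add, MonObj.comp_mul, whiskerRight_fst_assoc,
      whiskerRight_snd_assoc, i₁_p₁, i₁_p₂, AddMonObj.comp_zero, mul_zero, add_zero]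
  · simp only [AddMonObj.comp_add, MonObj.comp_mul, whiskerRight_fst_assoc,
      whiskerRight_snd_assoc, i₂_p₁, i₂_p₂, AddMonObj.comp_zero, mul_zero, zero_add, h0]
  · rintro f ⟨h1, h2⟩
    obtain ⟨e, rfl⟩ := (L.bij_D₂ X).2 f
    simp only [AddMonObj.comp_add, MonObj.comp_mul,
      whiskerRight_fst_assoc, whiskerRight_snd_assoc, i₁_p₁, i₁_p₂, i₂_p₁, i₂_p₂,
      AddMonObj.comp_zero, mul_zero, zero_add, add_zero] at h1 h2
    have k1 := (L.bij_D X).1 (a₁ := Sum.elim (fun _ => e (.inl ())) (fun _ => e (.inr 0))) h1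
    have k2 := (L.bij_D X).1 (a₁ := Sum.elim (fun _ => e (.inl ())) (fun _ => e (.inr 1))) h2
    rw [← k1, ← k2]
    rfl

/-- A morphism into `M` on `D(2)` is the same as a pair of morphisms on `D` agreeing at `0`. -/
lemma exists_unique_D₂ [L.KockLawvere] (M : C) [L.Microlinear M] (X : C) (a b : L.D 1 ⊗ X ⟶ M)
    (h : L.zero 1 (𝟙_ C) ▷ X ≫ a = L.zero 1 (𝟙_ C) ▷ X ≫ b) :
    ∃! f : L.D₂ ⊗ X ⟶ M, L.i₁ ▷ X ≫ f = a ∧ L.i₂ ▷ X ≫ f = b := by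
  have hR : PerceivesAsColimit (PushoutCocone.mk L.i₁ L.i₂ L.zero_i) L.R :=
    (perceives_pushout_iff _ _).2 L.ring_D₂
  have := Microlinear.perceives (L := L) (M := M) WalkingSpan _ _ (by
    intro j
    match j with
    | none => exact L.isInfinitesimal_unit
    | some .left => exact L.isInfinitesimal_D
    | some .right => exact L.isInfinitesimal_D) L.isInfinitesimal_D₂ hR
  exact (perceives_pushout_iff _ M).1 this X a b h

lemma ring_mulD [L.KockLawvere] (X : C) (a : (L.D 1 ⊗ L.D 1) ⊗ X ⟶ L.R)
    (ha : L.toProd ▷ X ≫ a = lift (L.zero 1 L.D₂) (L.zero 1 L.D₂) ▷ X ≫ a) :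
    ∃! f : L.D 1 ⊗ X ⟶ L.R, L.mulD ▷ X ≫ f = a := by
  obtain ⟨a', rfl⟩ : ∃ a', a = (α_ _ _ _).hom ≫ a' := ⟨(α_ _ _ _).inv ≫ a, by simp⟩
  obtain ⟨c, rfl⟩ := (L.bij_D _).2 a'
  obtain ⟨p, hp⟩ := (L.bij_D _).2 (c (.inl ()))
  obtain ⟨q, hq⟩ := (L.bij_D _).2 (c (.inr ()))
  simp only [← hp, ← hq] at ha ⊢
  simp only [AddMonObj.comp_add, MonObj.comp_mul, toProd, associator_hom_fst_assoc,
    associator_hom_snd_fst_assoc, associator_hom_snd_snd_assoc, whiskerRight_fst_assoc,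
    whiskerRight_snd_assoc, lift_fst_assoc, lift_snd_assoc, pt_incl, zero_incl,
    AddMonObj.comp_zero, mul_zero, add_zero, add_mul] at ha ⊢
  have hz : (fst L.D₂ X ≫ L.p₂) * (fst L.D₂ X ≫ L.p₁) = 0 := by
    rw [← MonObj.comp_mul, mul_comm, L.D₂_rel.2.1, AddMonObj.comp_zero]
  rw [mul_assoc (snd L.D₂ X ≫ q (.inr ())), hz, mul_zero, add_zero] at ha
  have k := (L.bij_D₂ X).1 (a₁ := Sum.elim (fun _ => p (.inl ())) ![q (.inl ()), p (.inr ())])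
    (a₂ := Sum.elim (fun _ => p (.inl ())) 0) (by
      simp only [Sum.elim_inl, Sum.elim_inr, Pi.zero_apply, AddMonObj.comp_zero, zero_mul, add_zero]
      refine Eq.trans ?_ ha
      simp only [Matrix.cons_val_zero, Matrix.cons_val_one]
      ring)
  have k1 : q (.inl ()) = 0 := congrFun k (.inr 0)
  have k2 : p (.inr ()) = 0 := congrFun k (.inr 1)
  have hm : ∀ s t : X ⟶ L.R, L.mulD ▷ X ≫ (snd (L.D 1) X ≫ s +
      (snd (L.D 1) X ≫ t) * (fst (L.D 1) X ≫ L.incl 1)) =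
      (α_ _ _ _).hom ≫ (snd _ _ ≫ snd _ _ ≫ s +
        (snd _ _ ≫ ((snd _ _ ≫ t) * (fst _ _ ≫ L.incl 1))) * (fst _ _ ≫ L.incl 1)) := by
    intro s t
    simp only [AddMonObj.comp_add, MonObj.comp_mul, associator_hom_fst_assoc,
      associator_hom_snd_fst_assoc, associator_hom_snd_snd_assoc, whiskerRight_fst_assoc,
      whiskerRight_snd_assoc, mulD, scale_incl]
    ring
  have key : ∀ T, L.mulD ▷ X ≫ (snd (L.D 1) X ≫ p (.inl ()) +
      (snd (L.D 1) X ≫ q (.inr ())) * (fst (L.D 1) X ≫ L.incl 1)) = T →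
      ∃! f : L.D 1 ⊗ X ⟶ L.R, L.mulD ▷ X ≫ f = T := by
    refine fun T hT => ⟨_, hT, fun f hf => ?_⟩
    obtain ⟨e, rfl⟩ := (L.bij_D X).2 f
    have hf' := hf.trans hT.symm
    dsimp only at hf'
    rw [hm, hm, cancel_epi] at hf'
    have k3 := (L.bij_D (L.D 1 ⊗ X)).1
      (a₁ := Sum.elim (fun _ => snd _ _ ≫ e (.inl ()))
        (fun _ => (snd _ _ ≫ e (.inr ())) * (fst _ _ ≫ L.incl 1)))
      (a₂ := Sum.elim (fun _ => snd _ _ ≫ p (.inl ()))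
        (fun _ => (snd _ _ ≫ q (.inr ())) * (fst _ _ ≫ L.incl 1))) hf'
    have k4 : e (.inl ()) = p (.inl ()) := const_inj (L.zero 1 _) (congrFun k3 (.inl ()))
    have k5 : (snd (L.D 1) X ≫ e (.inr ())) * (fst _ _ ≫ L.incl 1) =
        (snd (L.D 1) X ≫ q (.inr ())) * (fst _ _ ≫ L.incl 1) := congrFun k3 (.inr ())
    have k6 := (L.bij_D X).1 (a₁ := Sum.elim (fun _ => 0) (fun _ => e (.inr ())))
      (a₂ := Sum.elim (fun _ => 0) (fun _ => q (.inr ()))) (by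
        simp only [Sum.elim_inl, Sum.elim_inr, k5])
    have k7 : e (.inr ()) = q (.inr ()) := congrFun k6 (.inr ())
    simp only [k4, k7]
  apply key
  rw [hm]
  simp only [k1, k2, AddMonObj.comp_add, MonObj.comp_mul, associator_hom_fst_assoc,
    associator_hom_snd_fst_assoc, associator_hom_snd_snd_assoc, AddMonObj.comp_zero, zero_mul,
    add_zero, zero_add]

/-- A morphism into `M` on `D × D` which is constant on `D(2)` factors uniquely through the
multiplication `D × D → D`. -/
lemma exists_unique_mulD [L.KockLawvere] (M : C) [L.Microlinear M] (X : C)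
    (a : (L.D 1 ⊗ L.D 1) ⊗ X ⟶ M)
    (h : L.toProd ▷ X ≫ a = lift (L.zero 1 L.D₂) (L.zero 1 L.D₂) ▷ X ≫ a) :
    ∃! f : L.D 1 ⊗ X ⟶ M, L.mulD ▷ X ≫ f = a := by
  have hw : L.toProd ≫ L.mulD = lift (L.zero 1 L.D₂) (L.zero 1 L.D₂) ≫ L.mulD := by
    apply D_ext
    simp [mulD, toProd, comp_scale, L.D₂_rel.2.1]
  have hR : PerceivesAsColimit (Cofork.ofπ L.mulD hw) L.R :=
    (perceives_cofork_iff _ _).2 L.ring_mulD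
  have := Microlinear.perceives (L := L) (M := M) WalkingParallelPair _ _ (by
    intro j
    match j with
    | .zero => exact L.isInfinitesimal_D₂
    | .one => exact L.isInfinitesimal_prod) L.isInfinitesimal_D hR
  exact (perceives_cofork_iff _ M).1 this X a h

lemma zero_diag : L.zero 1 (𝟙_ C) ≫ L.diag = L.zero 1 (𝟙_ C) ≫ L.i₁ := by
  apply D₂_ext <;> simp [diag, AddMonObj.comp_zero]

/-- The first projection `D(2) → D`. -/
def q₁ : L.D₂ ⟶ L.D 1 := pt L.p₁ L.D₂_rel.1

/-- The second projection `D(2) → D`. -/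
def q₂ : L.D₂ ⟶ L.D 1 := pt L.p₂ L.D₂_rel.2.2

/-- The map `d ↦ -d` of `D`. -/
def negD : L.D 1 ⟶ L.D 1 := scale (-1) (𝟙 _)

lemma i₁_q₁ : L.i₁ ≫ L.q₁ = 𝟙 _ := by apply D_ext; simp [q₁]
lemma i₁_q₂ : L.i₁ ≫ L.q₂ = L.zero 1 _ := by apply D_ext; simp [q₂]
lemma i₂_q₁ : L.i₂ ≫ L.q₁ = L.zero 1 _ := by apply D_ext; simp [q₁]
lemma i₂_q₂ : L.i₂ ≫ L.q₂ = 𝟙 _ := by apply D_ext; simp [q₂]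
lemma diag_q₁ : L.diag ≫ L.q₁ = 𝟙 _ := by apply D_ext; simp [q₁, diag]
lemma diag_q₂ : L.diag ≫ L.q₂ = 𝟙 _ := by apply D_ext; simp [q₂, diag]
lemma toProd_fst : L.toProd ≫ fst _ _ = L.q₁ := by simp [toProd, q₁]
lemma toProd_snd : L.toProd ≫ snd _ _ = L.q₂ := by simp [toProd, q₂]

variable {L} in
lemma scale_zero {X : C} (r : X ⟶ L.R) :
    lift (L.zero 1 X) (𝟙 X) ≫ lift (scale (snd _ _ ≫ r) (fst _ _)) (snd _ _) =
      lift (L.zero 1 X) (𝟙 X) := by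
  apply CartesianMonoidalCategory.hom_ext
  · apply D_ext
    simp [comp_scale]
  · simp

variable {L} in
lemma D₂_hom_ext [L.KockLawvere] {M : C} [L.Microlinear M] {X : C} {f g : L.D₂ ⊗ X ⟶ M}
    (h₁ : L.i₁ ▷ X ≫ f = L.i₁ ▷ X ≫ g) (h₂ : L.i₂ ▷ X ≫ f = L.i₂ ▷ X ≫ g) : f = g :=
  (L.exists_unique_D₂ M X (L.i₁ ▷ X ≫ g) (L.i₂ ▷ X ≫ g) (by
    rw [← comp_whiskerRight_assoc, zero_i, comp_whiskerRight_assoc])).unique ⟨h₁, h₂⟩ ⟨rfl, rfl⟩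

section LieAlgebra

variable [MonoidalClosed C]

/-- The pointwise group structure on `G ^ U`. -/
instance grpExp (U G : C) [GrpObj G] : GrpObj ((ihom U).obj G) :=
  GrpObj.ofRepresentableBy _ ((tensorLeft U).op ⋙ yonedaGrpObj G)
    { homEquiv := ⟨MonoidalClosed.uncurry, MonoidalClosed.curry,
        MonoidalClosed.curry_uncurry, MonoidalClosed.uncurry_curry⟩
      homEquiv_comp := fun f g => MonoidalClosed.uncurry_natural_left f g }

section

variable (G : C)

/-- Evaluation of tangent vectors `D → G` at `0`. -/
def evZero : (ihom (L.D 1)).obj G ⟶ G :=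
  lift (L.zero 1 _) (𝟙 _) ≫ (ihom.ev (L.D 1)).app G

variable [GrpObj G]

/-- The object underlying the Lie algebra of `G`: the tangent space `{t ∈ G ^ D | t 0 = 1}`. -/
def Lie : C := equalizer (L.evZero G) 1

/-- The inclusion of the Lie algebra of `G` in `G ^ D`. -/
def lieIncl : L.Lie G ⟶ (ihom (L.D 1)).obj G := equalizer.ι _ _

instance : Mono (L.lieIncl G) := inferInstanceAs (Mono (equalizer.ι _ _))

lemma lieIncl_evZero : L.lieIncl G ≫ L.evZero G = 1 :=
  (equalizer.condition (L.evZero G) 1).trans (MonObj.comp_one _)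

end

variable {L} {G : C} {X : C}

lemma curry_evZero (f : L.D 1 ⊗ X ⟶ G) :
    MonoidalClosed.curry f ≫ L.evZero G = lift (L.zero 1 X) (𝟙 X) ≫ f := by
  have h : MonoidalClosed.curry f ≫ lift (L.zero 1 _) (𝟙 ((ihom (L.D 1)).obj G)) =
      lift (L.zero 1 X) (𝟙 X) ≫ (L.D 1 ◁ MonoidalClosed.curry f) := by
    ext <;> simp
  rw [evZero, ← Category.assoc, h, Category.assoc, ← MonoidalClosed.uncurry_eq,
    MonoidalClosed.uncurry_curry]

variable [GrpObj G]

/-- An element `t` of the Lie algebra at stage `X`, viewed as a family of maps `D → G`. -/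
def tangent (t : X ⟶ L.Lie G) : L.D 1 ⊗ X ⟶ G :=
  MonoidalClosed.uncurry (t ≫ L.lieIncl G)

lemma tangent_zero (t : X ⟶ L.Lie G) : lift (L.zero 1 X) (𝟙 X) ≫ tangent t = 1 := by
  rw [← curry_evZero, tangent, MonoidalClosed.curry_uncurry, Category.assoc,
    lieIncl_evZero, MonObj.comp_one]

/-- The element of the Lie algebra given by a family of maps `D → G` sending `0` to `1`. -/
def ofTangent (f : L.D 1 ⊗ X ⟶ G) (h : lift (L.zero 1 X) (𝟙 X) ≫ f = 1) : X ⟶ L.Lie G :=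
  equalizer.lift (MonoidalClosed.curry f) (by rw [curry_evZero, h, MonObj.comp_one])

@[simp] lemma tangent_ofTangent (f : L.D 1 ⊗ X ⟶ G) (h : lift (L.zero 1 X) (𝟙 X) ≫ f = 1) :
    tangent (ofTangent f h) = f :=
  (congrArg MonoidalClosed.uncurry (equalizer.lift_ι _ _)).trans (MonoidalClosed.uncurry_curry f)

lemma tangent_injective {s t : X ⟶ L.Lie G} (h : tangent s = tangent t) : s = t :=
  (cancel_mono (L.lieIncl G)).1 (MonoidalClosed.uncurry_injective h)

lemma tangent_comp {Y : C} (g : Y ⟶ X) (t : X ⟶ L.Lie G) :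
    tangent (g ≫ t) = L.D 1 ◁ g ≫ tangent t := by
  rw [tangent, Category.assoc, MonoidalClosed.uncurry_natural_left, tangent]

/-- Tangent vectors have value `1` at `0`. -/
lemma zero_whisker (Y : C) (t : X ⟶ L.Lie G) : L.zero 1 Y ▷ X ≫ tangent t = 1 := by
  have : L.zero 1 Y ▷ X = snd Y X ≫ lift (L.zero 1 X) (𝟙 X) := by ext <;> simp
  rw [this, Category.assoc, tangent_zero, MonObj.comp_one]

lemma zero_of_whisker {f : L.D 1 ⊗ X ⟶ G} (h : L.zero 1 (𝟙_ C) ▷ X ≫ f = 1) :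
    lift (L.zero 1 X) (𝟙 X) ≫ f = 1 := by
  have : lift (L.zero 1 X) (𝟙 X) = lift (toUnit X) (𝟙 X) ≫ L.zero 1 (𝟙_ C) ▷ X := by
    ext <;> simp
  rw [this, Category.assoc, h, MonObj.comp_one]

/-- Scalar multiplication of tangent vectors: `(r • t) d = t (r * d)`. -/
instance : SMul (X ⟶ L.R) (X ⟶ L.Lie G) where
  smul r t := ofTangent (lift (scale (snd _ _ ≫ r) (fst _ _)) (snd _ _) ≫ tangent t) (by
    rw [← Category.assoc, scale_zero, tangent_zero])

/-- The zero tangent vector is constant. -/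
instance : Zero (X ⟶ L.Lie G) where
  zero := ofTangent 1 (MonObj.comp_one _)

instance : Neg (X ⟶ L.Lie G) where
  neg t := (-1 : X ⟶ L.R) • t

lemma tangent_smul (r : X ⟶ L.R) (t : X ⟶ L.Lie G) :
    tangent (r • t) = lift (scale (snd _ _ ≫ r) (fst _ _)) (snd _ _) ≫ tangent t :=
  tangent_ofTangent _ _

lemma tangent_zero_vec : tangent (0 : X ⟶ L.Lie G) = 1 := tangent_ofTangent _ _

lemma neg_def (t : X ⟶ L.Lie G) : -t = (-1 : X ⟶ L.R) • t := rfl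

lemma smul_one' (t : X ⟶ L.Lie G) : (1 : X ⟶ L.R) • t = t := by
  apply tangent_injective
  rw [tangent_smul]
  have : lift (scale (snd _ _ ≫ (1 : X ⟶ L.R)) (fst (L.D 1) X)) (snd _ _) = 𝟙 _ := by
    apply CartesianMonoidalCategory.hom_ext
    · apply D_ext
      simp [MonObj.comp_one]
    · simp
  rw [this, Category.id_comp]

lemma smul_zero' (t : X ⟶ L.Lie G) : (0 : X ⟶ L.R) • t = 0 := by
  apply tangent_injective
  rw [tangent_smul, tangent_zero_vec]
  have : lift (scale (snd _ _ ≫ (0 : X ⟶ L.R)) (fst (L.D 1) X)) (snd _ _) =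
      snd _ _ ≫ lift (L.zero 1 X) (𝟙 X) := by
    apply CartesianMonoidalCategory.hom_ext
    · apply D_ext
      simp [AddMonObj.comp_zero]
    · simp
  rw [this, Category.assoc, tangent_zero, MonObj.comp_one]

lemma smul_mul' (r s : X ⟶ L.R) (t : X ⟶ L.Lie G) : (r * s) • t = r • s • t := by
  apply tangent_injective
  rw [tangent_smul, tangent_smul, tangent_smul, ← Category.assoc]
  congr 1
  apply CartesianMonoidalCategory.hom_ext
  · apply D_ext
    simp [comp_scale, MonObj.comp_mul]
    ring
  · simp

/-- The commutator `(d, e) ↦ s d * t e * s (-d) * t (-e)` of two tangent vectors. -/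
def commutator (s t : X ⟶ L.Lie G) : (L.D 1 ⊗ L.D 1) ⊗ X ⟶ G :=
  fst (L.D 1) (L.D 1) ▷ X ≫ tangent s * snd (L.D 1) (L.D 1) ▷ X ≫ tangent t *
    (fst (L.D 1) (L.D 1) ≫ L.negD) ▷ X ≫ tangent s * (snd (L.D 1) (L.D 1) ≫ L.negD) ▷ X ≫ tangent t

variable [L.KockLawvere] [L.Microlinear G]

/-- For tangent vectors `s` and `t`, there is a unique `l : D(2) → G` with `l (d, 0) = s d` and
`l (0, d) = t d`. -/
lemma exists_sum (s t : X ⟶ L.Lie G) :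
    ∃! l : L.D₂ ⊗ X ⟶ G, L.i₁ ▷ X ≫ l = tangent s ∧ L.i₂ ▷ X ≫ l = tangent t :=
  L.exists_unique_D₂ G X _ _ (by rw [zero_whisker, zero_whisker])

/-- The sum of tangent vectors: `(s + t) d = l (d, d)`, where `l : D(2) → G` is the unique map
with `l (d, 0) = s d` and `l (0, d) = t d`. -/
instance : Add (X ⟶ L.Lie G) where
  add s t := ofTangent (L.diag ▷ X ≫ (exists_sum s t).choose) (by
    apply zero_of_whisker
    rw [← comp_whiskerRight_assoc, zero_diag, comp_whiskerRight_assoc,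
      (exists_sum s t).choose_spec.1.1, zero_whisker])

lemma tangent_add_eq {s t : X ⟶ L.Lie G} (l : L.D₂ ⊗ X ⟶ G) (h₁ : L.i₁ ▷ X ≫ l = tangent s)
    (h₂ : L.i₂ ▷ X ≫ l = tangent t) : tangent (s + t) = L.diag ▷ X ≫ l := by
  rw [(exists_sum s t).choose_spec.2 l ⟨h₁, h₂⟩]
  exact tangent_ofTangent _ _

/-- Tangent vectors commute on `D(2)`. -/
lemma commute_D₂ (s t : X ⟶ L.Lie G) :
    L.q₁ ▷ X ≫ tangent s * L.q₂ ▷ X ≫ tangent t =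
      L.q₂ ▷ X ≫ tangent t * L.q₁ ▷ X ≫ tangent s := by
  apply D₂_hom_ext <;>
  simp only [MonObj.comp_mul, ← comp_whiskerRight_assoc, i₁_q₁, i₁_q₂, i₂_q₁, i₂_q₂, zero_whisker,
    one_mul, mul_one]

/-- The sum of tangent vectors to a group at `1` is their pointwise product. -/
lemma tangent_add (s t : X ⟶ L.Lie G) :
    tangent (s + t) = tangent s * tangent t := by
  rw [tangent_add_eq (L.q₁ ▷ X ≫ tangent s * L.q₂ ▷ X ≫ tangent t)]
  · simp only [MonObj.comp_mul, ← comp_whiskerRight_assoc, diag_q₁, diag_q₂]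
    simp
  · simp only [MonObj.comp_mul, ← comp_whiskerRight_assoc, i₁_q₁, i₁_q₂, zero_whisker, mul_one]
    simp
  · simp only [MonObj.comp_mul, ← comp_whiskerRight_assoc, i₂_q₁, i₂_q₂, zero_whisker, one_mul]
    simp

lemma add_smul' (r s : X ⟶ L.R) (t : X ⟶ L.Lie G) :
    (r + s) • t = r • t + s • t := by
  have hsq : ((snd L.D₂ X ≫ r) * (fst L.D₂ X ≫ L.p₁) + (snd L.D₂ X ≫ s) * (fst L.D₂ X ≫ L.p₂)) ^
      (1 + 1) = 0 := by
    obtain ⟨h₁, h₂, h₃⟩ := L.D₂_rel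
    have k₁ : (fst L.D₂ X ≫ L.p₁) ^ 2 = 0 := by rw [← MonObj.comp_pow, h₁, AddMonObj.comp_zero]
    have k₂ : (fst L.D₂ X ≫ L.p₁) * (fst L.D₂ X ≫ L.p₂) = 0 := by
      rw [← MonObj.comp_mul, h₂, AddMonObj.comp_zero]
    have k₃ : (fst L.D₂ X ≫ L.p₂) ^ 2 = 0 := by rw [← MonObj.comp_pow, h₃, AddMonObj.comp_zero]
    linear_combination (snd L.D₂ X ≫ r) ^ 2 * k₁ + (snd L.D₂ X ≫ s) ^ 2 * k₃ +
      2 * (snd L.D₂ X ≫ r) * (snd L.D₂ X ≫ s) * k₂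
  apply tangent_injective
  rw [tangent_add_eq (lift (pt _ hsq) (snd _ _) ≫ tangent t)]
  all_goals
    rw [tangent_smul, ← Category.assoc]
    congr 1
    apply CartesianMonoidalCategory.hom_ext
    · apply D_ext
      simp [MonObj.comp_mul, AddMonObj.comp_add, AddMonObj.comp_zero, diag, add_mul]
    · simp

/-- The additive group structure of the Lie algebra. -/
instance : AddCommGroup (X ⟶ L.Lie G) where
  add_assoc a b c := tangent_injective (by simp only [tangent_add, mul_assoc])
  zero_add a := tangent_injective (by rw [tangent_add, tangent_zero_vec, one_mul])
  add_zero a := tangent_injective (by rw [tangent_add, tangent_zero_vec, mul_one])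
  nsmul := nsmulRec
  zsmul := zsmulRec
  neg_add_cancel a := by
    nth_rw 2 [← smul_one' a]
    rw [neg_def, ← add_smul', neg_add_cancel, smul_zero']
  add_comm a b := by
    apply tangent_injective
    have h := congr(L.diag ▷ X ≫ $(commute_D₂ a b))
    simp only [MonObj.comp_mul, ← comp_whiskerRight_assoc, diag_q₁, diag_q₂] at h
    simpa [tangent_add] using h

/-- The Lie algebra is a module over `R`. -/
instance : Module (X ⟶ L.R) (X ⟶ L.Lie G) where
  one_smul := smul_one'
  mul_smul := smul_mul'
  smul_zero r := tangent_injective (by rw [tangent_smul, tangent_zero_vec, MonObj.comp_one])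
  smul_add r s t := tangent_injective (by
    simp only [tangent_smul, tangent_add, MonObj.comp_mul])
  add_smul := add_smul'
  zero_smul := smul_zero'

lemma negD_tangent (t : X ⟶ L.Lie G) :
    L.negD ▷ X ≫ tangent t = (tangent t)⁻¹ := by
  have h : L.negD ▷ X ≫ tangent t = tangent (-t) := by
    rw [neg_def, tangent_smul]
    congr 1
    apply CartesianMonoidalCategory.hom_ext
    · apply D_ext
      simp [negD, comp_scale, AddGrpObj.comp_neg, MonObj.comp_one]
    · simp
  rw [h, eq_inv_iff_mul_eq_one, ← tangent_add, neg_add_cancel, tangent_zero_vec]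

lemma commutator_eq (s t : X ⟶ L.Lie G) : commutator s t =
    fst (L.D 1) (L.D 1) ▷ X ≫ tangent s * snd (L.D 1) (L.D 1) ▷ X ≫ tangent t *
      (fst (L.D 1) (L.D 1) ▷ X ≫ tangent s)⁻¹ * (snd (L.D 1) (L.D 1) ▷ X ≫ tangent t)⁻¹ := by
  simp only [commutator, comp_whiskerRight_assoc, negD_tangent, GrpObj.comp_inv]

/-- For tangent vectors `s` and `t` to `G` at `1`, there is a unique tangent vector `b` such that
`b (d * e) = s d * t e * s (-d) * t (-e)` for all `d` and `e` in `D`. -/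
lemma exists_bracket (s t : X ⟶ L.Lie G) :
    ∃! b : X ⟶ L.Lie G, L.mulD ▷ X ≫ tangent b = commutator s t := by
  obtain ⟨f, hf, hu⟩ := L.exists_unique_mulD G X (commutator s t) (by
    simp only [commutator_eq, MonObj.comp_mul, GrpObj.comp_inv, ← comp_whiskerRight_assoc,
      toProd_fst, toProd_snd, lift_fst, lift_snd, zero_whisker]
    rw [commute_D₂]
    group)
  refine ⟨ofTangent f ?_, ?_, fun b hb => tangent_injective ?_⟩
  · have : lift (L.zero 1 X) (𝟙 X) =
        lift (lift (L.zero 1 X) (L.zero 1 X)) (𝟙 X) ≫ L.mulD ▷ X := by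
      apply CartesianMonoidalCategory.hom_ext
      · apply D_ext
        simp [mulD, comp_scale]
      · simp
    rw [this, Category.assoc, hf, commutator_eq]
    simp only [MonObj.comp_mul, GrpObj.comp_inv, lift_whiskerRight_assoc, lift_fst, lift_snd,
      tangent_zero]
    group
  · exact (congrArg (L.mulD ▷ X ≫ ·) (tangent_ofTangent f _)).trans hf
  · rw [tangent_ofTangent]
    exact hu _ hb

/-- The Lie bracket: `⁅s, t⁆` is the unique tangent vector such that
`⁅s, t⁆ (d * e) = s d * t e * s (-d) * t (-e)` for all `d` and `e` in `D`. -/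
instance : Bracket (X ⟶ L.Lie G) (X ⟶ L.Lie G) where
  bracket s t := (exists_bracket s t).choose

end LieAlgebra

section Exponential

variable [MonoidalClosed C]

/-- The isomorphism `E ⊗ (U ⊗ X) ≅ U ⊗ (E ⊗ X)`. -/
def swap (E U X : C) : E ⊗ (U ⊗ X) ⟶ U ⊗ (E ⊗ X) :=
  lift (snd _ _ ≫ fst _ _) (lift (fst _ _) (snd _ _ ≫ snd _ _))

lemma swap_swap (E U X : C) : swap E U X ≫ swap U E X = 𝟙 _ := by
  ext <;> simp [swap]

variable {L} in
lemma uncurry_one (U G : C) [GrpObj G] (X : C) :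
    MonoidalClosed.uncurry (1 : X ⟶ (ihom U).obj G) = 1 :=
  (MonoidalClosed.uncurry_natural_left (toUnit X) _).trans
    ((congrArg (U ◁ toUnit X ≫ ·) (MonoidalClosed.uncurry_curry 1)).trans (MonObj.comp_one _))

/-- The identification `Lie (G ^ U) = (Lie G) ^ U`: by the exponential law, both sides are the
object of those `f : U × D → G` which satisfy `f (u, 0) = 1`. -/
def lieExp (U G : C) [GrpObj G] : L.Lie ((ihom U).obj G) ≅ (ihom U).obj (L.Lie G) :=
  Yoneda.ext _ _
    (fun {X} t => MonoidalClosed.curry (ofTangent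
      (swap (L.D 1) U X ≫ MonoidalClosed.uncurry (tangent t)) (by
        have h : lift (L.zero 1 (U ⊗ X)) (𝟙 _) ≫ swap (L.D 1) U X =
          U ◁ lift (L.zero 1 X) (𝟙 X) := by ext <;> simp [swap]
        rw [← Category.assoc, h, ← MonoidalClosed.uncurry_natural_left, tangent_zero,
          uncurry_one])))
    (fun {X} t => ofTangent
      (MonoidalClosed.curry (swap U (L.D 1) X ≫ tangent (MonoidalClosed.uncurry t))) (by
        have h : U ◁ lift (L.zero 1 X) (𝟙 X) ≫ swap U (L.D 1) X =
          lift (L.zero 1 (U ⊗ X)) (𝟙 _) := by ext <;> simp [swap]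
        rw [← MonoidalClosed.curry_natural_left, ← Category.assoc, h, tangent_zero,
          MonoidalClosed.curry_eq_iff, uncurry_one]))
    (fun {X} t => tangent_injective (by
      simp only [MonoidalClosed.uncurry_curry, tangent_ofTangent]
      rw [← Category.assoc, swap_swap, Category.id_comp, MonoidalClosed.curry_uncurry]))
    (fun {X} t => MonoidalClosed.uncurry_injective (tangent_injective (by
      simp only [MonoidalClosed.uncurry_curry, tangent_ofTangent]
      rw [← Category.assoc, swap_swap, Category.id_comp])))
    (fun {X Y} g t => by
      rw [← MonoidalClosed.curry_natural_left]
      congr 1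
      apply tangent_injective
      have h : swap (L.D 1) U Y ≫ U ◁ L.D 1 ◁ g = L.D 1 ◁ U ◁ g ≫ swap (L.D 1) U X := by
        ext <;> simp [swap]
      rw [tangent_ofTangent, tangent_comp, tangent_comp, tangent_ofTangent,
        MonoidalClosed.uncurry_natural_left, ← Category.assoc, h, Category.assoc])

/-- The element `∑ i ≤ n, A i * d ^ i` of `(Lie G) ^ (D n)`, i.e. the map
`d ↦ ∑ i ≤ n, d ^ i • A i` from `D n` to `Lie G`. -/
def polynomial (G : C) [GrpObj G] [L.KockLawvere] [L.Microlinear G] (n : ℕ) {X : C}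
    (A : ℕ → (X ⟶ L.Lie G)) : X ⟶ (ihom (L.D n)).obj (L.Lie G) :=
  MonoidalClosed.curry
    (∑ i ∈ Finset.range (n + 1), (fst (L.D n) X ≫ L.incl n) ^ i • (snd (L.D n) X ≫ A i))

end Exponential

end AlgObj

end SDG

end

noncomputable section

namespace SDG

open scoped MonObj AddMonObj RingObj CommRingObj TensorProduct

namespace AlgObj

variable {k : Type w} [CommRing k] {C : Type u} [Category.{v} C] [CartesianMonoidalCategory C]
  [BraidedCategory C] [HasFiniteLimits C] [MonoidalClosed C] {L : AlgObj k C}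

/-! ### Naturality and bilinearity of the bracket at an arbitrary stage. -/

section Bracket

variable {G X : C} [GrpObj G]

/-! The group law of `G ^ U` is pointwise, and a bracket is determined by its commutator equation on
`D × D`. Hence the bracket of `Lie (G ^ U)`, read in `(Lie G) ^ U`, is also pointwise
(`bracket_curry_comp_lieExp_inv`). For `U = D n`, bracketing two polynomial maps `D n → Lie G`
therefore means bracketing the elements `∑ d ^ i • A i` and `∑ d ^ j • B j` of `Lie G` at the stage
`D n ⊗ X`, where `d` is the generic element of `D n`.

At any stage the bracket is bilinear over the elements of `R` (`add_bracket`, `bracket_add`,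
`smul_bracket`, `bracket_smul`). The bracket thus expands to the double sum of the `d ^ (i + j) • ⁅A
i, B j⁆`. The terms with `i + j > n` vanish because `d ^ (n + 1) = 0`, and the others are grouped by
`m = i + j` (`bracket_polynomial`). Finally, brackets are natural in the stage (`comp_bracket`), so
the coefficients are the brackets already formed at the stage `X`.

The substantial point of bilinearity is additivity. In a group, `[a a', b] = a [a', b] a⁻¹ [a, b]`,
and a sum of tangent vectors is their pointwise product, so it remains to remove a conjugation. Here
`a = s d` and `[a', b] = ⁅s', t⁆ (d * e)`. They commute because `(d, d * e)` lies in `D(2)`, on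
which any two tangent vectors commute (`commute_D₂`). -/

lemma comp_commutator {Y : C} (f : Y ⟶ X) (s t : X ⟶ L.Lie G) :
    commutator (f ≫ s) (f ≫ t) = _ ◁ f ≫ commutator s t := by
  simp only [commutator, tangent_comp, MonObj.comp_mul, whisker_exchange_assoc]

variable [L.KockLawvere] [L.Microlinear G]

lemma mulD_tangent_bracket (s t : X ⟶ L.Lie G) :
    L.mulD ▷ X ≫ tangent ⁅s, t⁆ = commutator s t :=
  (exists_bracket s t).choose_spec.1

/-- The working form of uniqueness: the identities below are proved by checking that the proposed
tangent vector, evaluated at `d * e`, gives the right commutator. Uniqueness comes from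
microlinearity, by which `G` perceives `L.mulD` as a quotient map. -/
lemma eq_bracket {s t b : X ⟶ L.Lie G} (h : L.mulD ▷ X ≫ tangent b = commutator s t) :
    b = ⁅s, t⁆ :=
  (exists_bracket s t).unique h (mulD_tangent_bracket s t)

/-- The Lie bracket is natural in the stage. -/
lemma comp_bracket {Y : C} (f : Y ⟶ X) (s t : X ⟶ L.Lie G) : f ≫ ⁅s, t⁆ = ⁅f ≫ s, f ≫ t⁆ := by
  apply eq_bracket
  rw [tangent_comp, ← whisker_exchange_assoc, mulD_tangent_bracket, comp_commutator]

/-- The values of two tangent vectors at `d` and `d * e` commute. -/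
lemma commute_fst_mulD (s t : X ⟶ L.Lie G) :
    Commute (fst (L.D 1) (L.D 1) ▷ X ≫ tangent s) (L.mulD ▷ X ≫ tangent t) := by
  -- The map `(d, e) ↦ (d, d * e)`; it lands in `D(2)` because `d * (d * e) = d ^ 2 * e = 0`. The
  -- claim is `commute_D₂` pulled back along it.
  let f : L.D 1 ⊗ L.D 1 ⟶ L.D₂ :=
    pt₂ (fst _ _ ≫ L.incl 1) (L.mulD ≫ L.incl 1) (pt_pow _) (by
      rw [mulD, scale_incl, ← mul_assoc, ← sq, pt_pow, zero_mul]) (pt_pow _)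
  have h₁ : f ≫ L.q₁ = fst _ _ := D_ext (by simp [f, q₁])
  have h₂ : f ≫ L.q₂ = L.mulD := D_ext (by simp [f, q₂])
  have h := congr(f ▷ X ≫ $(commute_D₂ s t))
  simpa only [Commute, SemiconjBy, MonObj.comp_mul, ← comp_whiskerRight_assoc, h₁, h₂] using h

/-- The values of two tangent vectors at `e` and `d * e` commute. -/
lemma commute_snd_mulD (s t : X ⟶ L.Lie G) :
    Commute (snd (L.D 1) (L.D 1) ▷ X ≫ tangent s) (L.mulD ▷ X ≫ tangent t) := by
  -- Here the map is `(d, e) ↦ (e, d * e)`, and `e * (d * e) = d * e ^ 2 = 0`.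
  let f : L.D 1 ⊗ L.D 1 ⟶ L.D₂ :=
    pt₂ (snd _ _ ≫ L.incl 1) (L.mulD ≫ L.incl 1) (pt_pow _) (by
      rw [mulD, scale_incl, mul_left_comm, ← sq, pt_pow, mul_zero]) (pt_pow _)
  have h₁ : f ≫ L.q₁ = snd _ _ := D_ext (by simp [f, q₁])
  have h₂ : f ≫ L.q₂ = L.mulD := D_ext (by simp [f, q₂])
  have h := congr(f ▷ X ≫ $(commute_D₂ s t))
  simpa only [Commute, SemiconjBy, MonObj.comp_mul, ← comp_whiskerRight_assoc, h₁, h₂] using h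

/-- This is the group identity `[a a', b] = a [a', b] a⁻¹ [a, b]` with `a = s d`, `a' = s' d`, `b =
t e`; the conjugation by `a` is trivial by `commute_fst_mulD`. -/
lemma add_bracket (s s' t : X ⟶ L.Lie G) : ⁅s + s', t⁆ = ⁅s, t⁆ + ⁅s', t⁆ := by
  symm
  apply eq_bracket
  have h := commute_fst_mulD s ⁅s', t⁆
  -- The summands are exchanged because `[a', b]` precedes `[a, b]` in the group identity.
  rw [add_comm, tangent_add, MonObj.comp_mul]
  rw [mulD_tangent_bracket] at h ⊢
  -- The commuting factor is used to insert the conjugation by `s d`; what is left holds in every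
  -- group.
  rw [mulD_tangent_bracket, ← h.mul_inv_cancel]
  simp only [commutator_eq, tangent_add, MonObj.comp_mul]
  group

/-- Here the identity is `[a, b b'] = [a, b] b [a, b'] b⁻¹`, with `b = t e`. The factors are already
in the right order, and the conjugation by `b` is trivial by `commute_snd_mulD`. -/
lemma bracket_add (s t t' : X ⟶ L.Lie G) : ⁅s, t + t'⁆ = ⁅s, t⁆ + ⁅s, t'⁆ := by
  symm
  apply eq_bracket
  have h := commute_snd_mulD t ⁅s, t'⁆
  rw [tangent_add, MonObj.comp_mul]
  rw [mulD_tangent_bracket] at h ⊢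
  rw [mulD_tangent_bracket, ← h.mul_inv_cancel]
  simp only [commutator_eq, tangent_add, MonObj.comp_mul]
  group

/-- Since `r * (d * e) = (r * d) * e`, evaluating `r • ⁅s, t⁆` at `d * e` gives the commutator of
`s` and `t` at `(r * d, e)`, which is the commutator of `r • s` and `t` at `(d, e)`. -/
lemma smul_bracket (r : X ⟶ L.R) (s t : X ⟶ L.Lie G) : ⁅r • s, t⁆ = r • ⁅s, t⁆ := by
  symm
  apply eq_bracket
  -- The substitution `((d, e), x) ↦ ((r x * d, e), x)`.
  let f : (L.D 1 ⊗ L.D 1) ⊗ X ⟶ (L.D 1 ⊗ L.D 1) ⊗ X :=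
    lift (lift (scale (snd _ _ ≫ r) (fst _ _ ≫ fst _ _)) (fst _ _ ≫ snd _ _)) (snd _ _)
  have h₁ : L.mulD ▷ X ≫ lift (scale (snd _ _ ≫ r) (fst _ _)) (snd _ _) = f ≫ L.mulD ▷ X := by
    apply CartesianMonoidalCategory.hom_ext
    · apply D_ext
      simp [f, mulD, comp_scale, mul_assoc]
    · simp [f]
  have h₂ : f ≫ fst (L.D 1) (L.D 1) ▷ X ≫ tangent s =
      fst _ _ ▷ X ≫ lift (scale (snd _ _ ≫ r) (fst _ _)) (snd _ _) ≫ tangent s := by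
    rw [← Category.assoc, ← Category.assoc _ _ (tangent s)]
    congr 1
    apply CartesianMonoidalCategory.hom_ext <;> simp [f, comp_scale]
  have h₃ : f ≫ snd (L.D 1) (L.D 1) ▷ X ≫ tangent t = snd _ _ ▷ X ≫ tangent t := by
    rw [← Category.assoc]
    congr 1
    apply CartesianMonoidalCategory.hom_ext <;> simp [f]
  rw [tangent_smul, ← Category.assoc, h₁, Category.assoc, mulD_tangent_bracket]
  simp only [commutator_eq, tangent_smul, MonObj.comp_mul, GrpObj.comp_inv, h₂, h₃]

lemma bracket_smul (r : X ⟶ L.R) (s t : X ⟶ L.Lie G) : ⁅s, r • t⁆ = r • ⁅s, t⁆ := by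
  symm
  apply eq_bracket
  -- The scalar now goes into the second factor, `r * (d * e) = d * (r * e)`.
  let f : (L.D 1 ⊗ L.D 1) ⊗ X ⟶ (L.D 1 ⊗ L.D 1) ⊗ X :=
    lift (lift (fst _ _ ≫ fst _ _) (scale (snd _ _ ≫ r) (fst _ _ ≫ snd _ _))) (snd _ _)
  have h₁ : L.mulD ▷ X ≫ lift (scale (snd _ _ ≫ r) (fst _ _)) (snd _ _) = f ≫ L.mulD ▷ X := by
    apply CartesianMonoidalCategory.hom_ext
    · apply D_ext
      simp [f, mulD, comp_scale, mul_left_comm]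
    · simp [f]
  have h₂ : f ≫ snd (L.D 1) (L.D 1) ▷ X ≫ tangent t =
      snd _ _ ▷ X ≫ lift (scale (snd _ _ ≫ r) (fst _ _)) (snd _ _) ≫ tangent t := by
    rw [← Category.assoc, ← Category.assoc _ _ (tangent t)]
    congr 1
    apply CartesianMonoidalCategory.hom_ext <;> simp [f, comp_scale]
  have h₃ : f ≫ fst (L.D 1) (L.D 1) ▷ X ≫ tangent s = fst _ _ ▷ X ≫ tangent s := by
    rw [← Category.assoc]
    congr 1
    apply CartesianMonoidalCategory.hom_ext <;> simp [f]
  rw [tangent_smul, ← Category.assoc, h₁, Category.assoc, mulD_tangent_bracket]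
  simp only [commutator_eq, tangent_smul, MonObj.comp_mul, GrpObj.comp_inv, h₂, h₃]

lemma bracket_sum {I J : Type*} (S : Finset I) (T : Finset J) (a : I → (X ⟶ L.Lie G))
    (b : J → (X ⟶ L.Lie G)) :
    ⁅∑ i ∈ S, a i, ∑ j ∈ T, b j⁆ = ∑ i ∈ S, ∑ j ∈ T, ⁅a i, b j⁆ := by
  refine (map_sum (AddMonoidHom.mk' (fun s : X ⟶ L.Lie G => ⁅s, ∑ j ∈ T, b j⁆)
    fun s s' => add_bracket s s' _) a S).trans (Finset.sum_congr rfl fun i _ => ?_)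
  exact map_sum (AddMonoidHom.mk' (fun t : X ⟶ L.Lie G => ⁅a i, t⁆)
    fun t t' => bracket_add _ t t') b T

/-- Precomposition with `f`, as an additive homomorphism of Lie algebras. -/
def compHom {Y : C} (f : Y ⟶ X) : (X ⟶ L.Lie G) →+ (Y ⟶ L.Lie G) :=
  AddMonoidHom.mk' (f ≫ ·) fun s t => tangent_injective (by
    simp only [tangent_comp, tangent_add, MonObj.comp_mul])

/-! ### Brackets of truncated polynomials. -/

/-- The bracket of polynomials whose variable is an element of `D n`. -/
lemma bracket_polynomial {n : ℕ} (d : X ⟶ L.R) (hd : d ^ (n + 1) = 0)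
    (a b : ℕ → (X ⟶ L.Lie G)) :
    ⁅∑ i ∈ Finset.range (n + 1), d ^ i • a i, ∑ j ∈ Finset.range (n + 1), d ^ j • b j⁆ =
      ∑ m ∈ Finset.range (n + 1), d ^ m •
        ∑ p ∈ Finset.HasAntidiagonal.antidiagonal m, ⁅a p.1, b p.2⁆ := by
  -- Truncation: every product of total degree above `n` disappears. The coefficients are indexed by
  -- all of `ℕ`, but only those of index at most `n` occur on either side.
  have hpow : ∀ m, n < m → d ^ m = 0 := fun m hm => pow_eq_zero_of_le hm hd
  have hmul : ∀ i j, ⁅d ^ i • a i, d ^ j • b j⁆ = d ^ (i + j) • ⁅a i, b j⁆ := fun i j => by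
    rw [smul_bracket, bracket_smul, ← mul_smul, pow_add]
  rw [bracket_sum, ← Finset.sum_product']
  simp only [hmul]
  rw [← Finset.sum_filter_add_sum_filter_not _ (fun p : ℕ × ℕ => p.1 + p.2 ≤ n),
    Finset.sum_eq_zero (s := Finset.filter (fun p : ℕ × ℕ => ¬ p.1 + p.2 ≤ n) _) (fun p hp => by
      rw [hpow _ (not_le.1 (Finset.mem_filter.1 hp).2), zero_smul]), add_zero]
  simp only [Finset.smul_sum]
  rw [Finset.sum_sigma']
  -- The pairs `(i, j)` with `i, j ≤ n` and `i + j ≤ n` are exactly those on the antidiagonals of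
  -- the `m ≤ n`, since `i + j ≤ n` already forces `i, j ≤ n`.
  refine Finset.sum_bij' (fun p _ => ⟨p.1 + p.2, p⟩) (fun q _ => q.2) ?_ ?_ ?_ ?_ ?_
  · simp only [Finset.mem_filter, Finset.mem_product, Finset.mem_range, Finset.mem_sigma,
      Finset.HasAntidiagonal.mem_antidiagonal]
    exact fun p hp => ⟨Nat.lt_succ_of_le hp.2, trivial⟩
  · rintro ⟨m, p⟩
    simp only [Finset.mem_filter, Finset.mem_product, Finset.mem_range, Finset.mem_sigma,
      Finset.HasAntidiagonal.mem_antidiagonal]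
    intros; omega
  · intros; rfl
  · rintro ⟨m, p⟩ hq
    simp only [Finset.mem_sigma, Finset.HasAntidiagonal.mem_antidiagonal] at hq
    rw [Sigma.mk.injEq]
    exact ⟨hq.2, HEq.rfl⟩
  · intros; rfl

end Bracket

/-! ### The bracket under the exponential law. -/

section Exponential

variable {U G X : C} [GrpObj G]

lemma uncurry_mul (f g : X ⟶ (ihom U).obj G) :
    MonoidalClosed.uncurry (f * g) = MonoidalClosed.uncurry f * MonoidalClosed.uncurry g :=
  by
  -- The multiplication of `G ^ U` comes from representability, so by construction it is the curried
  -- product of the two universal evaluations. Naturality then gives the formula for all `f` and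
  -- `g`.
  have h : f * g = lift f g ≫ MonoidalClosed.curry
      (MonoidalClosed.uncurry (fst ((ihom U).obj G) ((ihom U).obj G)) *
        MonoidalClosed.uncurry (snd ((ihom U).obj G) ((ihom U).obj G))) := rfl
  rw [h, MonoidalClosed.uncurry_natural_left, MonoidalClosed.uncurry_curry, MonObj.comp_mul,
    ← MonoidalClosed.uncurry_natural_left, ← MonoidalClosed.uncurry_natural_left, lift_fst,
    lift_snd]

lemma uncurry_inv (f : X ⟶ (ihom U).obj G) :
    MonoidalClosed.uncurry f⁻¹ = (MonoidalClosed.uncurry f)⁻¹ := by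
  rw [eq_inv_iff_mul_eq_one, ← uncurry_mul, inv_mul_cancel, uncurry_one]

/-- Says that `lieExp` only exchanges the arguments in `D` and in `U`. As `lieExp` is built by the
Yoneda lemma, this is immediate for the universal element `𝟙`; naturality of `swap` and of `tangent`
carries it to every `t`. -/
lemma tangent_uncurry_comp_lieExp_hom (t : X ⟶ L.Lie ((ihom U).obj G)) :
    tangent (MonoidalClosed.uncurry (t ≫ (L.lieExp U G).hom)) =
      swap (L.D 1) U X ≫ MonoidalClosed.uncurry (tangent t) := by
  have h : tangent (MonoidalClosed.uncurry (L.lieExp U G).hom) =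
      swap (L.D 1) U _ ≫ MonoidalClosed.uncurry (tangent (𝟙 (L.Lie ((ihom U).obj G)))) :=
    (congrArg tangent (MonoidalClosed.uncurry_curry _)).trans (tangent_ofTangent _ _)
  have hs : L.D 1 ◁ U ◁ t ≫ swap (L.D 1) U _ = swap (L.D 1) U X ≫ U ◁ L.D 1 ◁ t := by
    ext <;> simp [swap]
  rw [MonoidalClosed.uncurry_natural_left, tangent_comp, h, ← Category.assoc, hs, Category.assoc,
    ← MonoidalClosed.uncurry_natural_left, ← tangent_comp, Category.comp_id]

lemma tangent_curry_comp_lieExp_inv (a : U ⊗ X ⟶ L.Lie G) :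
    tangent (MonoidalClosed.curry a ≫ (L.lieExp U G).inv) =
      MonoidalClosed.curry (swap U (L.D 1) X ≫ tangent a) := by
  have h := tangent_uncurry_comp_lieExp_hom (MonoidalClosed.curry a ≫ (L.lieExp U G).inv)
  rw [Category.assoc, Iso.inv_hom_id, Category.comp_id, MonoidalClosed.uncurry_curry] at h
  rw [h, ← Category.assoc, swap_swap, Category.id_comp, MonoidalClosed.curry_uncurry]

variable [L.KockLawvere] [L.Microlinear G]

/-- The bracket of `Lie (G ^ U) = (Lie G) ^ U` is computed pointwise. -/
lemma bracket_curry_comp_lieExp_inv (a b : U ⊗ X ⟶ L.Lie G) :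
    ⁅MonoidalClosed.curry a ≫ (L.lieExp U G).inv, MonoidalClosed.curry b ≫ (L.lieExp U G).inv⁆ =
      MonoidalClosed.curry ⁅a, b⁆ ≫ (L.lieExp U G).inv := by
  symm
  apply eq_bracket
  apply MonoidalClosed.uncurry_injective
  have h : ∀ {E E' : C} (p : E ⟶ E'), U ◁ p ▷ X ≫ swap U E' X = swap U E X ≫ p ▷ (U ⊗ X) :=
    fun p => by ext <;> simp [swap]
  -- Stated for arbitrary `p` so that one formula covers both `L.mulD`, for the bracket, and the two
  -- projections, for the factors of the commutator. After uncurrying, each side of the commutator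
  -- equation in `G ^ U` is the corresponding side in `G` at the stage `U ⊗ X`, precomposed with the
  -- same `swap`.
  have key : ∀ (p : L.D 1 ⊗ L.D 1 ⟶ L.D 1) (c : U ⊗ X ⟶ L.Lie G),
      MonoidalClosed.uncurry (p ▷ X ≫ tangent (MonoidalClosed.curry c ≫ (L.lieExp U G).inv)) =
        swap U _ X ≫ p ▷ (U ⊗ X) ≫ tangent c := fun p c => by
    rw [tangent_curry_comp_lieExp_inv, MonoidalClosed.uncurry_natural_left,
      MonoidalClosed.uncurry_curry, ← Category.assoc, h, Category.assoc]
  rw [key, mulD_tangent_bracket]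
  simp only [commutator_eq, uncurry_mul, uncurry_inv, key, MonObj.comp_mul, GrpObj.comp_inv]

end Exponential

end AlgObj

end SDG

end

theorem corollary3p1p2 {k : Type w} [CommRing k] {C : Type u} [Category.{v} C]
    [CartesianMonoidalCategory C] [BraidedCategory C] [HasFiniteLimits C] [MonoidalClosed C]
    (L : SDG.AlgObj k C) [L.KockLawvere] (G : C) [GrpObj G] [L.Microlinear G]
    (n : ℕ) (X : C) (A B : ℕ → (X ⟶ L.Lie G)) :
    ⁅L.polynomial G n A ≫ (L.lieExp (L.D n) G).inv,
        L.polynomial G n B ≫ (L.lieExp (L.D n) G).inv⁆ =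
      L.polynomial G n (fun m => ∑ p ∈ Finset.HasAntidiagonal.antidiagonal m, ⁅A p.1, B p.2⁆) ≫
        (L.lieExp (L.D n) G).inv := by
  rw [SDG.AlgObj.polynomial, SDG.AlgObj.polynomial, SDG.AlgObj.polynomial,
    SDG.AlgObj.bracket_curry_comp_lieExp_inv,
    SDG.AlgObj.bracket_polynomial _ (SDG.AlgObj.pt_pow (fst (L.D n) X))]
  -- Only the coefficients of `d ^ m` remain to be compared: on one side the brackets of the pulled
  -- back `A i` and `B j`, on the other the pullback of the sum of brackets formed at the stage `X`.
  congr! 5 with m _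
  refine ((map_sum (SDG.AlgObj.compHom (L := L) (G := G) (snd (L.D n) X)) _ _).trans ?_).symm
  exact Finset.sum_congr rfl fun p _ => SDG.AlgObj.comp_bracket _ _ _
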